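/- Let $u,\varphi:\mathbb{R}^3\to\mathbb{R}$ be locally integrable functions and $\omega\in\mathbb{R}$, and suppose that $(u,\varphi,\omega)$ is a solution, in the sense of distributions on $\mathbb{R}^3$ (with $\varphi u$ and $u^2$ locally integrable), of $$-\tfrac12\Delta u-\varphi u=\omega u,\qquad \Delta\varphi=4\pi u^2 .$$ Suppose that $u$ and $\varphi$ are radial (each agrees almost everywhere with a function of $|x|$), that $u\in H^1(\mathbb{R}^3)$, and that the weak gradient of $\varphi$ exists and satisfies $\int_{\mathbb{R}^3}|\nabla\varphi|^2\,dx<\infty$. Then $u=0$ almost everywhere and $\varphi$ is almost everywhere equal to a constant. If moreover $\varphi\in\mathcal{D}^{1,2}(\mathbb{R}^3)$, then $\varphi=0$ almost everywhere, so that $u\equiv\varphi\equiv0$. Here $\mathcal{D}^{1,2}(\mathbb{R}^3)$ is the closure of $C_c^\infty(\mathbb{R}^3)$ for the norm $\|\nabla\psi\|_{L^2}$, its elements being identified with functions in $L^6(\mathbb{R}^3)$ through the Sobolev inequality. -/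

import Mathlib

open MeasureTheory Filter Topology
open scoped Gradient Laplacian

/-- Three-dimensional Euclidean space (with the Euclidean norm and Lebesgue measure). -/
abbrev R3 : Type := EuclideanSpace ℝ (Fin 3)

/-- Test functions: the elements of `C_c^∞(ℝ³)`. -/
def IsTestFunction (ψ : R3 → ℝ) : Prop :=
  ContDiff ℝ (⊤ : ℕ∞) ψ ∧ HasCompactSupport ψ

/-- `G` is the weak (distributional) gradient of `f`: both are locally integrable and
`∫ f ∇ψ = - ∫ ψ G` for all test functions `ψ`. -/
def HasWeakGradient (f : R3 → ℝ) (G : R3 → R3) : Prop :=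
  LocallyIntegrable f ∧ LocallyIntegrable G ∧
    ∀ ψ : R3 → ℝ, IsTestFunction ψ → (∫ x, f x • ∇ ψ x) = -(∫ x, ψ x • G x)

/-- `∫ |∇f|² < ∞`: the function `f` has a weak gradient, and that gradient is in `L²`. -/
def HasL2Gradient (f : R3 → ℝ) : Prop :=
  ∃ G : R3 → R3, HasWeakGradient f G ∧ MemLp G 2

/-- The Sobolev space `H¹(ℝ³)` of real-valued functions. -/
def MemH1 (f : R3 → ℝ) : Prop :=
  MemLp f 2 ∧ HasL2Gradient f

/-- The space `D^{1,2}(ℝ³)`: the closure of `C_c^∞(ℝ³)` for the norm `‖∇ψ‖_{L²}`. By the Sobolev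
inequality `‖ψ‖_{L⁶} ≤ C ‖∇ψ‖_{L²}` a sequence that is Cauchy for this norm converges in `L⁶`, and
the element of the closure it defines is identified with its `L⁶` limit. -/
def MemD12 (f : R3 → ℝ) : Prop :=
  ∃ G : R3 → R3, HasWeakGradient f G ∧ MemLp G 2 ∧
    ∃ ψ : ℕ → R3 → ℝ, (∀ n, IsTestFunction (ψ n)) ∧
      Tendsto (fun n => eLpNorm (fun x => ∇ (ψ n) x - G x) 2 volume) atTop (𝓝 0) ∧
      Tendsto (fun n => eLpNorm (fun x => ψ n x - f x) 6 volume) atTop (𝓝 0)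

/-- `f` is radial: `f(x)` depends only on `|x|` (for almost every `x`, functions being identified
when they agree almost everywhere). -/
def IsRadial (f : R3 → ℝ) : Prop :=
  ∃ g : ℝ → ℝ, ∀ᵐ x : R3, f x = g ‖x‖

/-- `(u, φ, ω)` solves, in the sense of distributions on `ℝ³`,
`-½ Δu - φ u = ω u` and `Δφ = 4π u²`. -/
def IsMaxwellSchrodingerSolution (u φ : R3 → ℝ) (ω : ℝ) : Prop :=
  LocallyIntegrable u ∧ LocallyIntegrable φ ∧
  LocallyIntegrable (fun x => φ x * u x) ∧ LocallyIntegrable (fun x => u x ^ 2) ∧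
  (∀ ψ : R3 → ℝ, IsTestFunction ψ →
    -(1 / 2) * (∫ x, u x * Δ ψ x) - (∫ x, φ x * u x * ψ x) = ω * (∫ x, u x * ψ x)) ∧
  (∀ ψ : R3 → ℝ, IsTestFunction ψ →
    (∫ x, φ x * Δ ψ x) = 4 * Real.pi * (∫ x, u x ^ 2 * ψ x))

/-!
Let `g`, `γ` be the radial profiles of `u`, `φ`. Testing the two equations with radial test
functions turns them into ordinary differential equations on `(0, ∞)`
(`exists_ae_eq_of_radial_laplacian_eq`): almost everywhere `g` and `γ` equal `C¹` functions `U` and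
`Φ` with
`r² U' = Q = -2 ∫₀ʳ (Φ + ω) U s² ds` and `r² Φ' = m = 4π ∫₀ʳ U² s² ds`.
No constant of integration appears in the fluxes `Q` and `m`, because the test functions do not
have to vanish at the origin.

Put `w = r U`, so that `w'' = -2 (Φ + ω) w`. The energy `F = w'² + 2 (Φ + ω) w²` satisfies
`F' = 2 Φ' w² = 2 m U² ≥ 0`: the field `φ` is repulsive, hence `Φ` is nondecreasing. The energy is
squeezed from both ends of the half-line.

* At the origin, finiteness of the mass gives `Φ = O(1/r)`, then `Q = O(√r)`, `U = O(r^{-1/2})`,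
  `m = O(r²)`, and so `Φ = O(1)`. Therefore the potential part of `F` tends to zero and `F ≥ 0`
  (`IsRadialProfile.energy_nonneg`).
* At infinity `Φ` is bounded. If `F ≥ ε > 0` near infinity, then `(w w')' ≥ ε - C w²`, so that `w²`
  grows, although `w` is square integrable. Hence `F ≤ 0` (`IsRadialProfile.energy_nonpos`).

So `F = 0`, and `m U² = F' / 2 = 0` forces `U = 0` (`IsRadialProfile.eq_zero`); then `m = 0` and `Φ`
is constant. The argument makes no distinction according to the sign of `ω`. Finally, an element of
`D^{1,2}` lies in `L⁶`, which contains no nonzero constant.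
-/

open Set

/-! ### The radial system of ordinary differential equations -/

theorem hasDerivAt_intervalIntegral_zero {f : ℝ → ℝ} (hc : ContinuousOn f (Ioi 0))
    (hi : ∀ R, IntegrableOn f (Ioc 0 R)) {r : ℝ} (hr : 0 < r) :
    HasDerivAt (fun x => ∫ s in (0 : ℝ)..x, f s) (f r) r := by
  refine intervalIntegral.integral_hasDerivAt_right ?_ ?_ ?_
  · rw [intervalIntegrable_iff_integrableOn_Ioc_of_le hr.le]
    exact hi r
  · exact hc.stronglyMeasurableAtFilter isOpen_Ioi r hr
  · exact hc.continuousAt (Ioi_mem_nhds hr)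

theorem monotoneOn_of_hasDerivAt_nonneg {D : Set ℝ} (hD : Convex ℝ D) {f f' : ℝ → ℝ}
    (h : ∀ r ∈ D, HasDerivAt f (f' r) r) (h0 : ∀ r ∈ D, 0 ≤ f' r) : MonotoneOn f D :=
  monotoneOn_of_hasDerivWithinAt_nonneg hD
    (fun r hr => (h r hr).continuousAt.continuousWithinAt)
    (fun r hr => (h r (interior_subset hr)).hasDerivWithinAt)
    (fun r hr => h0 r (interior_subset hr))

theorem antitoneOn_of_hasDerivAt_nonpos {D : Set ℝ} (hD : Convex ℝ D) {f f' : ℝ → ℝ}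
    (h : ∀ r ∈ D, HasDerivAt f (f' r) r) (h0 : ∀ r ∈ D, f' r ≤ 0) : AntitoneOn f D :=
  antitoneOn_of_hasDerivWithinAt_nonpos hD
    (fun r hr => (h r hr).continuousAt.continuousWithinAt)
    (fun r hr => (h r (interior_subset hr)).hasDerivWithinAt)
    (fun r hr => h0 r (interior_subset hr))

/-- The radial form of the system, for profiles `U`, `Φ` on `(0, ∞)` with fluxes `Q = r² U'` and
`m = r² Φ'`. The fluxes are written as integrals from the origin: this encodes that the
equations hold across the origin, and not only on the punctured space. The constant `4π` is
replaced by an arbitrary `κ`. -/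
structure IsRadialProfile (κ ω : ℝ) (U Q Φ m : ℝ → ℝ) : Prop where
  hasDerivAt_U : ∀ r, 0 < r → HasDerivAt U (Q r / r ^ 2) r
  hasDerivAt_Φ : ∀ r, 0 < r → HasDerivAt Φ (m r / r ^ 2) r
  integrable_sq : IntegrableOn (fun s => U s ^ 2 * s ^ 2) (Ioi 0)
  integrable_prod : ∀ R, IntegrableOn (fun s => -2 * (Φ s + ω) * U s * s ^ 2) (Ioc 0 R)
  Q_eq : ∀ r, 0 < r → Q r = ∫ s in (0 : ℝ)..r, -2 * (Φ s + ω) * U s * s ^ 2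
  m_eq : ∀ r, 0 < r → m r = ∫ s in (0 : ℝ)..r, κ * U s ^ 2 * s ^ 2

namespace IsRadialProfile

variable {κ ω : ℝ} {U Q Φ m : ℝ → ℝ}

theorem continuousOn_U (h : IsRadialProfile κ ω U Q Φ m) : ContinuousOn U (Ioi 0) :=
  fun r hr => (h.hasDerivAt_U r hr).continuousAt.continuousWithinAt

theorem continuousOn_Φ (h : IsRadialProfile κ ω U Q Φ m) : ContinuousOn Φ (Ioi 0) :=
  fun r hr => (h.hasDerivAt_Φ r hr).continuousAt.continuousWithinAt

theorem integrable_mass (h : IsRadialProfile κ ω U Q Φ m) :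
    IntegrableOn (fun s => κ * U s ^ 2 * s ^ 2) (Ioi 0) := by
  simp only [mul_assoc]
  exact h.integrable_sq.const_mul κ

theorem hasDerivAt_m (h : IsRadialProfile κ ω U Q Φ m) {r : ℝ} (hr : 0 < r) :
    HasDerivAt m (κ * U r ^ 2 * r ^ 2) r := by
  have hc : ContinuousOn (fun s => κ * U s ^ 2 * s ^ 2) (Ioi 0) :=
    (continuousOn_const.mul (h.continuousOn_U.pow 2)).mul (continuousOn_id.pow 2)
  refine (hasDerivAt_intervalIntegral_zero hc
    (fun R => h.integrable_mass.mono_set Ioc_subset_Ioi_self) hr).congr_of_eventuallyEq ?_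
  filter_upwards [Ioi_mem_nhds hr] with x hx using h.m_eq x hx

theorem hasDerivAt_Q (h : IsRadialProfile κ ω U Q Φ m) {r : ℝ} (hr : 0 < r) :
    HasDerivAt Q (-2 * (Φ r + ω) * U r * r ^ 2) r := by
  have hc : ContinuousOn (fun s => -2 * (Φ s + ω) * U s * s ^ 2) (Ioi 0) :=
    ((continuousOn_const.mul (h.continuousOn_Φ.add continuousOn_const)).mul
      h.continuousOn_U).mul (continuousOn_id.pow 2)
  refine (hasDerivAt_intervalIntegral_zero hc h.integrable_prod hr).congr_of_eventuallyEq ?_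
  filter_upwards [Ioi_mem_nhds hr] with x hx using h.Q_eq x hx

theorem m_nonneg (h : IsRadialProfile κ ω U Q Φ m) (hκ : 0 < κ) {r : ℝ} (hr : 0 < r) :
    0 ≤ m r := by
  rw [h.m_eq r hr]
  exact intervalIntegral.integral_nonneg hr.le fun s _ => by positivity

theorem m_le_total (h : IsRadialProfile κ ω U Q Φ m) (hκ : 0 < κ) {r : ℝ} (hr : 0 < r) :
    m r ≤ ∫ s in Ioi (0 : ℝ), κ * U s ^ 2 * s ^ 2 := by
  rw [h.m_eq r hr, intervalIntegral.integral_of_le hr.le]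
  exact setIntegral_mono_set h.integrable_mass (Eventually.of_forall fun s => by positivity)
    Ioc_subset_Ioi_self.eventuallyLE

theorem monotoneOn_Φ (h : IsRadialProfile κ ω U Q Φ m) (hκ : 0 < κ) : MonotoneOn Φ (Ioi 0) :=
  monotoneOn_of_hasDerivAt_nonneg (convex_Ioi 0) h.hasDerivAt_Φ fun r hr =>
    div_nonneg (h.m_nonneg hκ hr) (sq_nonneg r)

theorem antitoneOn_Φ_add (h : IsRadialProfile κ ω U Q Φ m) (hκ : 0 < κ) :
    AntitoneOn (fun r => Φ r + (∫ s in Ioi (0 : ℝ), κ * U s ^ 2 * s ^ 2) * r⁻¹) (Ioi 0) := by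
  set M := ∫ s in Ioi (0 : ℝ), κ * U s ^ 2 * s ^ 2 with hM
  refine antitoneOn_of_hasDerivAt_nonpos (convex_Ioi 0)
    (fun r hr => (h.hasDerivAt_Φ r hr).add ((hasDerivAt_inv (ne_of_gt hr)).const_mul M)) ?_
  intro r hr
  have h1 := h.m_le_total hκ hr
  have h2 : m r / r ^ 2 + M * -(r ^ 2)⁻¹ = (m r - M) / r ^ 2 := by ring
  rw [h2]
  exact div_nonpos_of_nonpos_of_nonneg (by linarith) (sq_nonneg r)

/-- A first bound on the potential at the origin, from finiteness of the total mass. -/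
theorem exists_abs_potential_le_div (h : IsRadialProfile κ ω U Q Φ m) (hκ : 0 < κ) :
    ∃ A, 0 ≤ A ∧ ∀ r ∈ Ioc (0 : ℝ) 1, |Φ r + ω| ≤ A / r := by
  set M := ∫ s in Ioi (0 : ℝ), κ * U s ^ 2 * s ^ 2 with hM
  have hM0 : 0 ≤ M := (h.m_nonneg hκ one_pos).trans (h.m_le_total hκ one_pos)
  refine ⟨M + |Φ 1 + ω|, by positivity, fun r hr => ?_⟩
  have h1 := h.monotoneOn_Φ hκ hr.1 (mem_Ioi.2 one_pos) hr.2
  have h2 := h.antitoneOn_Φ_add hκ hr.1 (mem_Ioi.2 one_pos) hr.2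
  simp only [← hM, inv_one, mul_one] at h2
  have h3 : |Φ 1 + ω| ≤ |Φ 1 + ω| / r := by
    rw [le_div_iff₀ hr.1]
    exact mul_le_of_le_one_right (abs_nonneg _) hr.2
  have h4 : 0 ≤ M / r := div_nonneg hM0 hr.1.le
  rw [← div_eq_mul_inv] at h2
  rw [add_div, abs_le]
  constructor
  · linarith [neg_abs_le (Φ 1 + ω)]
  · linarith [le_abs_self (Φ 1 + ω)]

/-- The flux of `U` through the sphere of radius `r` is `O(√r)`: Young's inequality with
weight `√r` in `∫₀ʳ |U| s ds`. -/
theorem exists_abs_Q_le_sqrt (h : IsRadialProfile κ ω U Q Φ m) (hκ : 0 < κ) :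
    ∃ B, 0 ≤ B ∧ ∀ r ∈ Ioc (0 : ℝ) 1, |Q r| ≤ B * √r := by
  obtain ⟨A, hA, hΦ⟩ := h.exists_abs_potential_le_div hκ
  set N := ∫ s in Ioi (0 : ℝ), U s ^ 2 * s ^ 2 with hN
  have hN0 : 0 ≤ N := integral_nonneg fun s => by positivity
  refine ⟨A * (1 + N), by positivity, fun r hr => ?_⟩
  have hs : 0 < √r := Real.sqrt_pos.2 hr.1
  have hi : IntegrableOn (fun s => U s ^ 2 * s ^ 2) (Ioc 0 r) :=
    h.integrable_sq.mono_set Ioc_subset_Ioi_self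
  have hi1 : IntegrableOn (fun s => A * ((√r)⁻¹ + √r * (U s ^ 2 * s ^ 2))) (Ioc 0 r) :=
    (continuous_const.integrableOn_Ioc.add (hi.const_mul _)).const_mul _
  have h1 : |Q r| ≤ ∫ s in Ioc 0 r, A * ((√r)⁻¹ + √r * (U s ^ 2 * s ^ 2)) := by
    rw [h.Q_eq r hr.1, intervalIntegral.integral_of_le hr.1.le, ← Real.norm_eq_abs]
    refine norm_integral_le_of_norm_le hi1 ?_
    refine (ae_restrict_iff' measurableSet_Ioc).2 (Eventually.of_forall fun s hsr => ?_)
    have h2 := hΦ s ⟨hsr.1, hsr.2.trans hr.2⟩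
    have h3 : ‖-2 * (Φ s + ω) * U s * s ^ 2‖ = 2 * |Φ s + ω| * |U s| * s ^ 2 := by
      simp
    rw [h3]
    have h4 : 2 * |Φ s + ω| * |U s| * s ^ 2 ≤ 2 * (A / s) * |U s| * s ^ 2 := by gcongr
    have h5 : 2 * (A / s) * |U s| * s ^ 2 = A * (2 * (|U s| * s)) := by
      have := hsr.1.ne'
      field_simp
    rw [h5] at h4
    refine h4.trans (mul_le_mul_of_nonneg_left ?_ hA)
    have h6 : U s ^ 2 * s ^ 2 = (|U s| * s) ^ 2 := by rw [mul_pow, sq_abs]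
    rw [h6]
    have h7 : (√r)⁻¹ + √r * (|U s| * s) ^ 2 - 2 * (|U s| * s)
        = (√r)⁻¹ * (1 - √r * (|U s| * s)) ^ 2 := by
      field_simp
      ring
    have h8 : 0 ≤ (√r)⁻¹ * (1 - √r * (|U s| * s)) ^ 2 := by positivity
    linarith
  have h2 : ∫ s in Ioc 0 r, U s ^ 2 * s ^ 2 ≤ N :=
    setIntegral_mono_set h.integrable_sq (Eventually.of_forall fun s => by positivity)
      Ioc_subset_Ioi_self.eventuallyLE
  have h3 : ∫ s in Ioc 0 r, A * ((√r)⁻¹ + √r * (U s ^ 2 * s ^ 2))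
      = A * (r * (√r)⁻¹ + √r * ∫ s in Ioc 0 r, U s ^ 2 * s ^ 2) := by
    rw [integral_const_mul, integral_add continuous_const.integrableOn_Ioc
      (hi.const_mul _), integral_const_mul]
    simp [hr.1.le]
  have h4 : r * (√r)⁻¹ = √r := by
    rw [← div_eq_mul_inv, Real.div_sqrt]
  rw [h3, h4] at h1
  refine h1.trans ?_
  have : A * (√r + √r * ∫ s in Ioc 0 r, U s ^ 2 * s ^ 2) ≤ A * (√r + √r * N) := by gcongr
  linarith

theorem hasDerivAt_inv_sqrt {r : ℝ} (hr : 0 < r) :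
    HasDerivAt (fun x : ℝ => (√x)⁻¹) (-(1 / (2 * √r)) / √r ^ 2) r :=
  (Real.hasDerivAt_sqrt hr.ne').inv (Real.sqrt_pos.2 hr).ne'

/-- `U = O(r^{-1/2})` at the origin. -/
theorem exists_sq_mul_le (h : IsRadialProfile κ ω U Q Φ m) (hκ : 0 < κ) :
    ∃ C, 0 ≤ C ∧ ∀ r ∈ Ioc (0 : ℝ) 1, U r ^ 2 * r ≤ C := by
  obtain ⟨B, hB, hQ⟩ := h.exists_abs_Q_le_sqrt hκ
  refine ⟨(|U 1| + 2 * B) ^ 2, by positivity, fun r hr => ?_⟩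
  have hd : ∀ s ∈ Ioc (0 : ℝ) 1, |Q s / s ^ 2| ≤ 2 * B * ((1 / (2 * √s)) / √s ^ 2) := by
    intro s hs
    have h0 : 0 < √s := Real.sqrt_pos.2 hs.1
    have h1 := hQ s hs
    rw [abs_div, abs_of_nonneg (sq_nonneg s), div_le_iff₀ (pow_pos hs.1 2)]
    refine h1.trans (le_of_eq ?_)
    have h2 : s ^ 2 = √s ^ 4 := by
      nth_rewrite 1 [← Real.sq_sqrt hs.1.le]
      ring
    rw [h2]
    field_simp
  have ha : AntitoneOn (fun s => U s + 2 * B * (√s)⁻¹) (Ioc 0 1) := by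
    refine antitoneOn_of_hasDerivAt_nonpos (convex_Ioc 0 1)
      (fun s hs => (h.hasDerivAt_U s hs.1).add ((hasDerivAt_inv_sqrt hs.1).const_mul _)) ?_
    intro s hs
    have := (abs_le.1 (hd s hs)).2
    rw [neg_div, mul_neg]
    linarith
  have hb : MonotoneOn (fun s => U s - 2 * B * (√s)⁻¹) (Ioc 0 1) := by
    refine monotoneOn_of_hasDerivAt_nonneg (convex_Ioc 0 1)
      (fun s hs => (h.hasDerivAt_U s hs.1).sub ((hasDerivAt_inv_sqrt hs.1).const_mul _)) ?_
    intro s hs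
    have := (abs_le.1 (hd s hs)).1
    rw [neg_div, mul_neg]
    linarith
  have h1 := ha hr ⟨one_pos, le_rfl⟩ hr.2
  have h2 := hb hr ⟨one_pos, le_rfl⟩ hr.2
  simp only [Real.sqrt_one, inv_one, mul_one] at h1 h2
  have h0 : 0 < √r := Real.sqrt_pos.2 hr.1
  have h3 : |U r| ≤ |U 1| + 2 * B * (√r)⁻¹ := by
    rw [abs_le]
    constructor
    · linarith [neg_abs_le (U 1)]
    · linarith [le_abs_self (U 1)]
  have h4 : |U r| * √r ≤ |U 1| + 2 * B := by
    have h5 : |U r| * √r ≤ (|U 1| + 2 * B * (√r)⁻¹) * √r := by gcongr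
    have h6 : (|U 1| + 2 * B * (√r)⁻¹) * √r = |U 1| * √r + 2 * B := by
      field_simp
    have h7 : |U 1| * √r ≤ |U 1| :=
      mul_le_of_le_one_right (abs_nonneg _) (Real.sqrt_le_one.2 hr.2)
    linarith
  have h5 : U r ^ 2 * r = (|U r| * √r) ^ 2 := by
    rw [mul_pow, sq_abs, Real.sq_sqrt hr.1.le]
  rw [h5]
  gcongr

/-- The potential is bounded at the origin: with `U = O(r^{-1/2})` the mass is `O(r²)`, so
`Φ'` is bounded. -/
theorem exists_abs_potential_le (h : IsRadialProfile κ ω U Q Φ m) (hκ : 0 < κ) :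
    ∃ K, 0 ≤ K ∧ ∀ r ∈ Ioc (0 : ℝ) 1, |Φ r + ω| ≤ K := by
  obtain ⟨C, hC, hU⟩ := h.exists_sq_mul_le hκ
  have hm : ∀ r ∈ Ioc (0 : ℝ) 1, m r ≤ κ * C * r ^ 2 := by
    intro r hr
    rw [h.m_eq r hr.1]
    have h1 : ∫ s in (0 : ℝ)..r, κ * U s ^ 2 * s ^ 2 ≤ ∫ _ in (0 : ℝ)..r, κ * C * r := by
      rw [intervalIntegral.integral_of_le hr.1.le, intervalIntegral.integral_of_le hr.1.le]
      refine setIntegral_mono_on (h.integrable_mass.mono_set Ioc_subset_Ioi_self)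
        continuous_const.integrableOn_Ioc measurableSet_Ioc fun s hs => ?_
      have h2 := hU s ⟨hs.1, hs.2.trans hr.2⟩
      calc κ * U s ^ 2 * s ^ 2 = κ * (U s ^ 2 * s) * s := by ring
        _ ≤ κ * C * r := by
          have := hs.1.le
          have := hs.2
          gcongr
    refine h1.trans (le_of_eq ?_)
    simp only [intervalIntegral.integral_const, smul_eq_mul]
    ring
  have ha : AntitoneOn (fun s => Φ s - κ * C * s) (Ioc 0 1) := by
    refine antitoneOn_of_hasDerivAt_nonpos (convex_Ioc 0 1)
      (fun s hs => (h.hasDerivAt_Φ s hs.1).sub ((hasDerivAt_id s).const_mul _)) ?_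
    intro s hs
    have := (div_le_iff₀ (pow_pos hs.1 2)).2 (hm s hs)
    linarith
  refine ⟨|Φ 1 + ω| + κ * C, by positivity, fun r hr => ?_⟩
  have h1 := ha hr ⟨one_pos, le_rfl⟩ hr.2
  have h2 := h.monotoneOn_Φ hκ hr.1 (mem_Ioi.2 one_pos) hr.2
  have h3 : 0 ≤ κ * C * r := mul_nonneg (by positivity) hr.1.le
  have h4 : 0 ≤ κ * C := by positivity
  simp only [mul_one] at h1
  rw [abs_le]
  constructor
  · linarith [neg_abs_le (Φ 1 + ω)]
  · linarith [le_abs_self (Φ 1 + ω)]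

theorem exists_abs_potential_le_of_one_le (h : IsRadialProfile κ ω U Q Φ m) (hκ : 0 < κ) :
    ∃ K, 0 ≤ K ∧ ∀ r, 1 ≤ r → |Φ r + ω| ≤ K := by
  set M := ∫ s in Ioi (0 : ℝ), κ * U s ^ 2 * s ^ 2 with hM
  have hM0 : 0 ≤ M := (h.m_nonneg hκ one_pos).trans (h.m_le_total hκ one_pos)
  refine ⟨M + |Φ 1 + ω|, by positivity, fun r hr => ?_⟩
  have hr0 : 0 < r := one_pos.trans_le hr
  have h1 := h.monotoneOn_Φ hκ (mem_Ioi.2 one_pos) hr0 hr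
  have h2 := h.antitoneOn_Φ_add hκ (mem_Ioi.2 one_pos) hr0 hr
  simp only [← hM, inv_one, mul_one] at h2
  have h4 : 0 ≤ M * r⁻¹ := by positivity
  rw [abs_le]
  constructor
  · linarith [neg_abs_le (Φ 1 + ω)]
  · linarith [le_abs_self (Φ 1 + ω)]

/-- The energy `w'² + 2 (Φ + ω) w²` of `w = r U`, where `w' = U + Q / r`. -/
noncomputable def energy (ω : ℝ) (U Q Φ : ℝ → ℝ) (r : ℝ) : ℝ :=
  (U r + Q r / r) ^ 2 + 2 * (Φ r + ω) * (r * U r) ^ 2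

theorem hasDerivAt_mul_U (h : IsRadialProfile κ ω U Q Φ m) {r : ℝ} (hr : 0 < r) :
    HasDerivAt (fun s => s * U s) (U r + Q r / r) r := by
  refine ((hasDerivAt_id' r).mul (h.hasDerivAt_U r hr)).congr_deriv ?_
  field_simp

theorem hasDerivAt_U_add (h : IsRadialProfile κ ω U Q Φ m) {r : ℝ} (hr : 0 < r) :
    HasDerivAt (fun s => U s + Q s / s) (-2 * (Φ r + ω) * (r * U r)) r := by
  refine ((h.hasDerivAt_U r hr).add
    ((h.hasDerivAt_Q hr).div (hasDerivAt_id' r) hr.ne')).congr_deriv ?_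
  field_simp
  ring

theorem hasDerivAt_energy (h : IsRadialProfile κ ω U Q Φ m) {r : ℝ} (hr : 0 < r) :
    HasDerivAt (energy ω U Q Φ) (2 * m r * U r ^ 2) r := by
  have h1 := (h.hasDerivAt_U_add hr).pow 2
  have h2 := (((h.hasDerivAt_Φ r hr).add_const ω).const_mul 2).mul
    ((h.hasDerivAt_mul_U hr).pow 2)
  refine (h1.add h2).congr_deriv ?_
  simp only [Pi.pow_apply, Nat.cast_ofNat, Nat.add_one_sub_one, pow_one]
  field_simp
  ring

theorem monotoneOn_energy (h : IsRadialProfile κ ω U Q Φ m) (hκ : 0 < κ) :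
    MonotoneOn (energy ω U Q Φ) (Ioi 0) :=
  monotoneOn_of_hasDerivAt_nonneg (convex_Ioi 0) (fun _ hr => h.hasDerivAt_energy hr)
    fun _ hr => mul_nonneg (mul_nonneg zero_le_two (h.m_nonneg hκ hr)) (sq_nonneg _)

/-- The potential part of the energy is `O(r)` at the origin, and the energy is nondecreasing. -/
theorem energy_nonneg (h : IsRadialProfile κ ω U Q Φ m) (hκ : 0 < κ) {r : ℝ} (hr : 0 < r) :
    0 ≤ energy ω U Q Φ r := by
  obtain ⟨C, hC, hU⟩ := h.exists_sq_mul_le hκ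
  obtain ⟨K, hK, hΦ⟩ := h.exists_abs_potential_le hκ
  have hlow : ∀ s ∈ Ioc (0 : ℝ) 1, -(2 * K * C * s) ≤ energy ω U Q Φ s := by
    intro s hs
    have h1 : |2 * (Φ s + ω) * (s * U s) ^ 2| ≤ 2 * K * C * s := by
      have h2 : |2 * (Φ s + ω) * (s * U s) ^ 2| = 2 * |Φ s + ω| * ((U s ^ 2 * s) * s) := by
        rw [abs_mul, abs_mul, abs_of_nonneg (sq_nonneg (s * U s)), abs_two]
        ring
      rw [h2]
      have h3 := hU s hs
      have h4 := hΦ s hs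
      have h5 := hs.1.le
      calc 2 * |Φ s + ω| * ((U s ^ 2 * s) * s) ≤ 2 * K * (C * s) := by gcongr
        _ = 2 * K * C * s := by ring
    have h6 := (abs_le.1 h1).1
    have h7 := sq_nonneg (U s + Q s / s)
    unfold energy
    linarith
  have hlim : Tendsto (fun s : ℝ => -(2 * K * C * s)) (𝓝[>] 0) (𝓝 0) := by
    have : Continuous fun s : ℝ => -(2 * K * C * s) := by fun_prop
    simpa using (this.tendsto 0).mono_left nhdsWithin_le_nhds
  refine le_of_tendsto hlim ?_
  have hmem : Ioc (0 : ℝ) (min 1 r) ∈ 𝓝[>] (0 : ℝ) := Ioc_mem_nhdsGT (lt_min one_pos hr)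
  filter_upwards [hmem] with s hs
  exact (hlow s ⟨hs.1, hs.2.trans (min_le_left _ _)⟩).trans
    (h.monotoneOn_energy hκ hs.1 hr (hs.2.trans (min_le_right _ _)))

/-- Were the energy equal to `ε > 0` at some radius, then `(w w')' ≥ ε - C w²` beyond it; as `w` is
square integrable, `w w'` and then `w²` would tend to infinity. -/
theorem energy_nonpos (h : IsRadialProfile κ ω U Q Φ m) (hκ : 0 < κ) {r : ℝ} (hr : 0 < r) :
    energy ω U Q Φ r ≤ 0 := by
  by_contra! hpos
  obtain ⟨K, hK, hΦ⟩ := h.exists_abs_potential_le_of_one_le hκ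
  set a := max 1 r with ha
  have ha1 : 1 ≤ a := le_max_left _ _
  have ha0 : 0 < a := one_pos.trans_le ha1
  set ε := energy ω U Q Φ r with hε
  set N := ∫ s in Ioi (0 : ℝ), U s ^ 2 * s ^ 2 with hN
  set p : ℝ → ℝ := fun s => (s * U s) * (U s + Q s / s) with hp
  set n : ℝ → ℝ := fun s => ∫ t in (0 : ℝ)..s, U t ^ 2 * t ^ 2 with hn
  have hn' : ∀ s, 0 < s → HasDerivAt n (U s ^ 2 * s ^ 2) s := fun s hs =>
    hasDerivAt_intervalIntegral_zero ((h.continuousOn_U.pow 2).mul (continuousOn_id.pow 2))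
      (fun R => h.integrable_sq.mono_set Ioc_subset_Ioi_self) hs
  have hn0 : ∀ s, 0 < s → 0 ≤ n s := fun s hs =>
    intervalIntegral.integral_nonneg hs.le fun t _ => by positivity
  have hnN : ∀ s, 0 < s → n s ≤ N := by
    intro s hs
    simp only [hn]
    rw [intervalIntegral.integral_of_le hs.le]
    exact setIntegral_mono_set h.integrable_sq (Eventually.of_forall fun s => by positivity)
      Ioc_subset_Ioi_self.eventuallyLE
  have hpos' : ∀ s ∈ Ici a, 0 < s := fun s hs => ha0.trans_le hs
  have hmono : MonotoneOn (fun s => p s + 4 * K * n s - ε * s) (Ici a) := by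
    refine monotoneOn_of_hasDerivAt_nonneg (convex_Ici a) (fun s hs =>
      (((h.hasDerivAt_mul_U (hpos' s hs)).mul (h.hasDerivAt_U_add (hpos' s hs))).add
        ((hn' s (hpos' s hs)).const_mul (4 * K))).sub ((hasDerivAt_id' s).const_mul ε)) ?_
    intro s hs
    have hs0 := hpos' s hs
    have h1 : ε ≤ energy ω U Q Φ s :=
      h.monotoneOn_energy hκ hr hs0 ((le_max_right _ _).trans hs)
    have h2 : (Φ s + ω) * (s * U s) ^ 2 ≤ K * (s * U s) ^ 2 := by
      gcongr
      exact (le_abs_self _).trans (hΦ s (ha1.trans hs))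
    unfold energy at h1
    nlinarith [h1, h2]
  set P := p a + 4 * K * n a - ε * a with hP
  set b := max a ((1 - P + 4 * K * N) / ε) with hb
  have hpb : ∀ s ∈ Ici b, 1 ≤ p s := by
    intro s hs
    have hsa : a ≤ s := (le_max_left _ _).trans hs
    have h1 := hmono self_mem_Ici hsa hsa
    have h2 : (1 - P + 4 * K * N) / ε ≤ s := (le_max_right _ _).trans hs
    rw [div_le_iff₀ hpos] at h2
    have h3 : 4 * K * n s ≤ 4 * K * N := by
      have := hnN s (hpos' s hsa)
      gcongr
    simp only [← hP] at h1
    linarith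
  have hb0 : 0 < b := ha0.trans_le (le_max_left _ _)
  have hgrow : MonotoneOn (fun s => (s * U s) ^ 2 - 2 * s) (Ici b) := by
    refine monotoneOn_of_hasDerivAt_nonneg (convex_Ici b) (fun s hs =>
      ((h.hasDerivAt_mul_U (hb0.trans_le hs)).pow 2).sub ((hasDerivAt_id' s).const_mul 2)) ?_
    intro s hs
    have h1 := hpb s hs
    simp only [hp] at h1
    simp only [Nat.cast_ofNat, Nat.add_one_sub_one, pow_one, mul_one]
    linarith
  have hbig : ∀ s ∈ Ioi (b + 1), 1 ≤ U s ^ 2 * s ^ 2 := by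
    intro s hs
    have hs' : b + 1 < s := hs
    have h1 := hgrow self_mem_Ici (show b ≤ s by linarith) (show b ≤ s by linarith)
    have h2 := sq_nonneg (b * U b)
    simp only at h1
    nlinarith [h1, h2]
  have hint : IntegrableOn (fun _ : ℝ => (1 : ℝ)) (Ioi (b + 1)) := by
    refine Integrable.mono' (h.integrable_sq.mono_set (Ioi_subset_Ioi (by linarith)))
      aestronglyMeasurable_const ?_
    refine (ae_restrict_iff' measurableSet_Ioi).2 (Eventually.of_forall fun s hs => ?_)
    simpa using hbig s hs
  rw [integrableOn_const_iff] at hint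
  simp at hint

/-- The only square integrable radial profile is zero: the energy vanishes identically, hence so
does its derivative `2 m U²`, and `m` is positive wherever `U` has been nonzero. -/
theorem eq_zero (h : IsRadialProfile κ ω U Q Φ m) (hκ : 0 < κ) {r : ℝ} (hr : 0 < r) :
    U r = 0 := by
  by_contra hU
  have hE : energy ω U Q Φ =ᶠ[𝓝 r] fun _ => 0 := by
    filter_upwards [Ioi_mem_nhds hr] with s hs
    exact le_antisymm (h.energy_nonpos hκ hs) (h.energy_nonneg hκ hs)
  have h1 : 2 * m r * U r ^ 2 = 0 :=
    (h.hasDerivAt_energy hr).unique ((hasDerivAt_const r (0 : ℝ)).congr_of_eventuallyEq hE)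
  have hm : m r = 0 := by simpa [hU] using h1
  -- A zero of the nonnegative function `m` is a minimum, so `m' = κ U² r²` vanishes there.
  have hmin : IsLocalMin m r := by
    filter_upwards [Ioi_mem_nhds hr] with s hs
    rw [hm]
    exact h.m_nonneg hκ hs
  have h2 := hmin.hasDerivAt_eq_zero (h.hasDerivAt_m hr)
  simp [hU, hκ.ne', hr.ne'] at h2

theorem m_eq_zero (h : IsRadialProfile κ ω U Q Φ m) (hκ : 0 < κ) {r : ℝ} (hr : 0 < r) :
    m r = 0 := by
  rw [h.m_eq r hr, intervalIntegral.integral_of_le hr.le]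
  refine (setIntegral_congr_fun measurableSet_Ioc fun s hs => ?_).trans (integral_zero _ _)
  simp [h.eq_zero hκ hs.1]

end IsRadialProfile

/-! ### Test functions on the half-line -/

/-- Elements of `C_c^∞(0, ∞)`, as functions on the whole line. -/
structure IsHalfLineTestFunction (χ : ℝ → ℝ) : Prop where
  contDiff : ContDiff ℝ (⊤ : ℕ∞) χ
  hasCompactSupport : HasCompactSupport χ
  tsupport_subset : tsupport χ ⊆ Ioi 0

theorem IsCompact.exists_subset_Ioo_of_subset_Ioi {K : Set ℝ} (hK : IsCompact K)
    (h : K ⊆ Ioi 0) : ∃ a b, 0 < a ∧ a < b ∧ K ⊆ Ioo a b := by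
  rcases K.eq_empty_or_nonempty with rfl | hne
  · exact ⟨1, 2, by norm_num, by norm_num, empty_subset _⟩
  · obtain ⟨p, hp⟩ := hK.exists_isLeast hne
    obtain ⟨q, hq⟩ := hK.exists_isGreatest hne
    have h0 : 0 < p := h hp.1
    refine ⟨p / 2, q + 1, by positivity, by linarith [hp.2 hq.1], fun x hx => ⟨?_, ?_⟩⟩
    · linarith [hp.2 hx]
    · linarith [hq.2 hx]

namespace IsHalfLineTestFunction

variable {χ : ℝ → ℝ}

theorem exists_bounds (h : IsHalfLineTestFunction χ) :
    ∃ a b, 0 < a ∧ a < b ∧ tsupport χ ⊆ Ioo a b :=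
  h.hasCompactSupport.isCompact.exists_subset_Ioo_of_subset_Ioi h.tsupport_subset

theorem continuous (h : IsHalfLineTestFunction χ) : Continuous χ := h.contDiff.continuous

theorem hasDerivAt (h : IsHalfLineTestFunction χ) (r : ℝ) : HasDerivAt χ (deriv χ r) r :=
  ((h.contDiff.differentiable (by simp)) r).hasDerivAt

theorem deriv (h : IsHalfLineTestFunction χ) : IsHalfLineTestFunction (deriv χ) :=
  ⟨(contDiff_infty_iff_deriv.1 h.contDiff).2, h.hasCompactSupport.deriv,
    tsupport_deriv_subset.trans h.tsupport_subset⟩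

theorem eq_zero (h : IsHalfLineTestFunction χ) {r : ℝ} (hr : r ≤ 0) : χ r = 0 :=
  image_eq_zero_of_notMem_tsupport fun h' => not_lt.2 hr (h.tsupport_subset h')

theorem integrable_mul (h : IsHalfLineTestFunction χ) {g : ℝ → ℝ}
    (hg : LocallyIntegrableOn g (Ioi 0)) : Integrable (fun r => g r * χ r) := by
  have h1 : IntegrableOn (fun r => g r * χ r) (tsupport χ) :=
    (hg.integrableOn_compact_subset h.tsupport_subset h.hasCompactSupport.isCompact).mul_continuousOn
      h.continuous.continuousOn h.hasCompactSupport.isCompact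
  refine (integrableOn_iff_integrable_of_support_subset ?_).1 h1
  exact (Function.support_mul_subset_right g χ).trans (subset_tsupport χ)

end IsHalfLineTestFunction

theorem setIntegral_Ioi_eq_intervalIntegral {f : ℝ → ℝ} {a b : ℝ} (ha : 0 ≤ a) (hab : a ≤ b)
    (hf : ∀ r, r ∉ Ioc a b → f r = 0) : ∫ r in Ioi 0, f r = ∫ r in a..b, f r := by
  rw [intervalIntegral.integral_of_le hab]
  exact setIntegral_eq_of_subset_of_forall_sdiff_eq_zero measurableSet_Ioi
    (fun r hr => ha.trans_lt hr.1) fun r hr => hf r hr.2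

/-- The primitive of a test function of zero integral is a test function. -/
theorem IsHalfLineTestFunction.exists_deriv_eq {η : ℝ → ℝ} (h : IsHalfLineTestFunction η)
    (h0 : ∫ r, η r = 0) : ∃ χ, IsHalfLineTestFunction χ ∧ _root_.deriv χ = η := by
  obtain ⟨a, b, ha, hab, hsub⟩ := h.exists_bounds
  have hz : ∀ r, r ∉ Ioo a b → η r = 0 := fun r hr =>
    image_eq_zero_of_notMem_tsupport fun h' => hr (hsub h')
  set χ : ℝ → ℝ := fun r => ∫ s in a..r, η s with hχ
  have hd : ∀ r, HasDerivAt χ (η r) r := fun r => h.continuous.integral_hasStrictDerivAt a r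
    |>.hasDerivAt
  have hd' : _root_.deriv χ = η := funext fun r => (hd r).deriv
  have hsupp : ∀ r, r ∉ Icc a b → χ r = 0 := by
    intro r hr
    rcases lt_or_ge r a with hra | hra
    · simp only [hχ]
      rw [intervalIntegral.integral_symm, intervalIntegral.integral_of_le hra.le]
      rw [setIntegral_eq_zero_of_forall_eq_zero, neg_zero]
      exact fun s hs => hz s fun h' => not_lt.2 hs.2 h'.1
    · have hbr : b < r := by
        by_contra! hcon
        exact hr ⟨hra, hcon⟩
      simp only [hχ]
      rw [intervalIntegral.integral_of_le hra, setIntegral_eq_integral_of_forall_compl_eq_zero, h0]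
      exact fun s hs => hz s fun h' => hs ⟨h'.1, h'.2.le.trans hbr.le⟩
  have hts : tsupport χ ⊆ Icc a b :=
    closure_minimal (fun r hr => by_contra fun h' => hr (hsupp r h')) isClosed_Icc
  refine ⟨χ, ⟨?_, ?_, ?_⟩, hd'⟩
  · rw [contDiff_infty_iff_deriv, hd']
    exact ⟨fun r => (hd r).differentiableAt, h.contDiff⟩
  · exact HasCompactSupport.intro isCompact_Icc hsupp
  · exact hts.trans fun r hr => ha.trans_le hr.1

/-- The lemma of du Bois-Reymond on the half-line. -/
theorem exists_ae_eq_const_of_integral_mul_deriv_eq_zero {g : ℝ → ℝ}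
    (hg : LocallyIntegrableOn g (Ioi 0))
    (h : ∀ χ, IsHalfLineTestFunction χ → ∫ r, g r * deriv χ r = 0) :
    ∃ c, ∀ᵐ r, r ∈ Ioi (0 : ℝ) → g r = c := by
  let B : ContDiffBump (2 : ℝ) := ⟨1 / 2, 1, by norm_num, by norm_num⟩
  set ρ : ℝ → ℝ := B.normed volume with hρ
  have hρt : IsHalfLineTestFunction ρ := by
    refine ⟨B.contDiff_normed, B.hasCompactSupport_normed, ?_⟩
    rw [hρ, B.tsupport_normed_eq, Real.closedBall_eq_Icc]
    intro x hx
    have : (2 : ℝ) - 1 ≤ x := hx.1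
    exact mem_Ioi.2 (by linarith)
  have hρ1 : ∫ r, ρ r = 1 := B.integral_normed
  refine ⟨∫ r, g r * ρ r, ?_⟩
  set c := ∫ r, g r * ρ r with hc
  have hloc : LocallyIntegrableOn (fun r => g r - c) (Ioi 0) :=
    hg.sub (continuous_const.locallyIntegrable.locallyIntegrableOn _)
  have key := isOpen_Ioi.ae_eq_zero_of_integral_contDiff_smul_eq_zero hloc ?_
  · filter_upwards [key] with r hr hr0 using sub_eq_zero.1 (hr hr0)
  intro η h1 h2 h3
  have hη : IsHalfLineTestFunction η := ⟨h1, h2, h3⟩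
  set J := ∫ r, η r with hJ
  have hηi : Integrable η := h1.continuous.integrable_of_hasCompactSupport h2
  have hρi : Integrable ρ := hρt.continuous.integrable_of_hasCompactSupport hρt.hasCompactSupport
  have hdiff : IsHalfLineTestFunction (fun r => η r - J * ρ r) := by
    have e1 : HasCompactSupport (fun r => J * ρ r) := hρt.hasCompactSupport.mul_left
    refine ⟨h1.sub (contDiff_const.mul hρt.contDiff), h2.sub e1, ?_⟩
    refine (tsupport_sub η (fun r => J * ρ r)).trans (union_subset h3 ?_)
    exact (closure_mono (Function.support_mul_subset_right _ ρ)).trans hρt.tsupport_subset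
  obtain ⟨χ, hχ, hχ'⟩ := hdiff.exists_deriv_eq (by
    rw [integral_sub hηi (hρi.const_mul J), integral_const_mul, hρ1, mul_one, sub_self])
  have h4 := h χ hχ
  rw [hχ'] at h4
  have i1 := hη.integrable_mul hg
  have i2 := hρt.integrable_mul hg
  have h5 : (fun r => g r * (η r - J * ρ r)) = fun r => g r * η r - J * (g r * ρ r) := by
    ext r; ring
  rw [h5, integral_sub i1 (i2.const_mul J), integral_const_mul, ← hc] at h4
  have h6 : (fun r => η r • (g r - c)) = fun r => g r * η r - c * η r := by
    ext r; simp only [smul_eq_mul]; ring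
  rw [h6, integral_sub i1 (hηi.const_mul c), integral_const_mul, ← hJ]
  linarith

theorem hasDerivAt_integral_one {q : ℝ → ℝ} (hq : ContinuousOn q (Ioi 0)) {r : ℝ} (hr : 0 < r) :
    HasDerivAt (fun r => ∫ s in (1 : ℝ)..r, q s) (q r) r :=
  intervalIntegral.integral_hasDerivAt_right
    (hq.mono fun _ hx => (lt_min one_pos hr).trans_le hx.1).intervalIntegrable
    (hq.stronglyMeasurableAtFilter isOpen_Ioi r hr) (hq.continuousAt (Ioi_mem_nhds hr))

/-- A function whose distributional derivative on the half-line is a continuous function `q` is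
a primitive of `q`. -/
theorem exists_ae_eq_const_add_integral {v q : ℝ → ℝ} (hv : LocallyIntegrableOn v (Ioi 0))
    (hq : ContinuousOn q (Ioi 0))
    (h : ∀ χ, IsHalfLineTestFunction χ →
      ∫ r in Ioi 0, v r * deriv χ r = -∫ r in Ioi 0, q r * χ r) :
    ∃ c, ∀ᵐ r, r ∈ Ioi (0 : ℝ) → v r = c + ∫ s in (1 : ℝ)..r, q s := by
  set V : ℝ → ℝ := fun r => ∫ s in (1 : ℝ)..r, q s with hV
  have hVd : ∀ r, 0 < r → HasDerivAt V (q r) r := fun r hr => hasDerivAt_integral_one hq hr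
  have hVc : ContinuousOn V (Ioi 0) := fun r hr => (hVd r hr).continuousAt.continuousWithinAt
  have hVl : LocallyIntegrableOn V (Ioi 0) := hVc.locallyIntegrableOn measurableSet_Ioi
  suffices hw : ∀ χ, IsHalfLineTestFunction χ → ∫ r, (v r - V r) * deriv χ r = 0 by
    obtain ⟨c, hc⟩ := exists_ae_eq_const_of_integral_mul_deriv_eq_zero (hv.sub hVl) hw
    refine ⟨c, ?_⟩
    filter_upwards [hc] with r hr hr0
    exact sub_eq_iff_eq_add.1 (hr hr0)
  intro χ hχ
  obtain ⟨a, b, ha, hab, hsub⟩ := hχ.exists_bounds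
  have hz : ∀ r, r ∉ Ioo a b → χ r = 0 := fun r hr =>
    image_eq_zero_of_notMem_tsupport fun h' => hr (hsub h')
  have hz' : ∀ r, r ∉ Ioo a b → deriv χ r = 0 := fun r hr =>
    image_eq_zero_of_notMem_tsupport fun h' => hr (hsub (tsupport_deriv_subset h'))
  have hIcc : ∀ r ∈ uIcc a b, 0 < r := fun r hr => by
    rw [uIcc_of_le hab.le] at hr
    exact ha.trans_le hr.1
  have h1 := intervalIntegral.integral_mul_deriv_eq_deriv_mul (a := a) (b := b)
    (fun r hr => hVd r (hIcc r hr)) (fun r _ => hχ.hasDerivAt r)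
    (hq.mono hIcc).intervalIntegrable (hχ.deriv.continuous.intervalIntegrable _ _)
  rw [hz a (fun h => lt_irrefl _ h.1), hz b (fun h => lt_irrefl _ h.2), mul_zero, mul_zero,
    sub_zero, zero_sub] at h1
  have h2 : ∫ r in Ioi 0, V r * deriv χ r = ∫ r in a..b, V r * deriv χ r :=
    setIntegral_Ioi_eq_intervalIntegral ha.le hab.le fun r hr => by
      rw [hz' r fun h' => hr (Ioo_subset_Ioc_self h'), mul_zero]
  have h3 : ∫ r in Ioi 0, q r * χ r = ∫ r in a..b, q r * χ r :=
    setIntegral_Ioi_eq_intervalIntegral ha.le hab.le fun r hr => by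
      rw [hz r fun h' => hr (Ioo_subset_Ioc_self h'), mul_zero]
  have h4 : ∫ r in Ioi 0, (v r - V r) * deriv χ r = ∫ r, (v r - V r) * deriv χ r :=
    setIntegral_eq_integral_of_forall_compl_eq_zero fun r hr => by
      rw [hχ.deriv.eq_zero (not_lt.1 hr), mul_zero]
  rw [← h4]
  simp only [sub_mul]
  rw [integral_sub (hχ.deriv.integrable_mul hv).integrableOn
    (hχ.deriv.integrable_mul hVl).integrableOn, h χ hχ, h2, h3, h1]
  ring

/-! ### Radial test functions and the radial Laplacian -/

theorem laplacian_comp_norm_sq {H K K' : ℝ → ℝ} (hH : ∀ t, HasDerivAt H (K t) t)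
    (hK : ∀ t, HasDerivAt K (K' t) t) (x : R3) :
    Δ (fun y : R3 => H (‖y‖ ^ 2)) x = 4 * ‖x‖ ^ 2 * K' (‖x‖ ^ 2) + 6 * K (‖x‖ ^ 2) := by
  have h1 : ∀ y : R3, HasFDerivAt (fun y : R3 => ‖y‖ ^ 2) (2 • innerSL ℝ y) y := fun y =>
    (hasStrictFDerivAt_norm_sq y).hasFDerivAt
  have h2 : fderiv ℝ (fun y : R3 => H (‖y‖ ^ 2)) =
      fun y : R3 => K (‖y‖ ^ 2) • (2 • innerSL ℝ y) :=
    funext fun y => ((hH _).comp_hasFDerivAt y (h1 y)).fderiv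
  have h3 : HasFDerivAt (fun y : R3 => 2 • innerSL ℝ y) (2 • innerSL ℝ : R3 →L[ℝ] R3 →L[ℝ] ℝ) x :=
    (2 • innerSL ℝ : R3 →L[ℝ] R3 →L[ℝ] ℝ).hasFDerivAt
  have h4 := ((hK _).comp_hasFDerivAt x (h1 x)).smul h3
  rw [InnerProductSpace.laplacian_eq_iteratedFDeriv_orthonormalBasis _
    (EuclideanSpace.basisFun (Fin 3) ℝ)]
  simp only [iteratedFDeriv_two_apply, h2]
  have h5 : fderiv ℝ (fun y : R3 => K (‖y‖ ^ 2) • (2 • innerSL ℝ y)) x = _ := h4.fderiv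
  rw [h5]
  have h6 : ∀ i : Fin 3, innerSL ℝ (EuclideanSpace.single i (1 : ℝ))
      (EuclideanSpace.single i (1 : ℝ)) = 1 := fun i => by
    rw [innerSL_apply_apply]
    simp
  simp [Fin.sum_univ_three, h6, EuclideanSpace.real_norm_sq_eq, EuclideanSpace.inner_single_right]
  ring

/-- A test function `χ` on the half-line is `r² η'` for a function `η` that is constant near the
origin and zero near infinity. Read as a radial function, `η` is a test function on `ℝ³`, also
across the origin, and its Laplacian is `χ' / r²`. In the statement `η(r) = H(r²)`. -/
theorem IsHalfLineTestFunction.exists_radial {χ : ℝ → ℝ} (h : IsHalfLineTestFunction χ) :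
    ∃ H : ℝ → ℝ, ContDiff ℝ (⊤ : ℕ∞) H ∧ IsTestFunction (fun x : R3 => H (‖x‖ ^ 2)) ∧
      (∀ x : R3, Δ (fun y : R3 => H (‖y‖ ^ 2)) x = _root_.deriv χ ‖x‖ / ‖x‖ ^ 2) ∧
      (∀ r, 0 < r → HasDerivAt (fun s => H (s ^ 2)) (χ r / r ^ 2) r) ∧
      ∃ b, ∀ r, b ≤ r → H (r ^ 2) = 0 := by
  obtain ⟨a, b, ha, hab, hsub⟩ := h.exists_bounds
  have hz : ∀ r, r ∉ Ioo a b → χ r = 0 := fun r hr =>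
    image_eq_zero_of_notMem_tsupport fun h' => hr (hsub h')
  have hb : 0 < b := ha.trans hab
  set K : ℝ → ℝ := fun t => χ (√t) / (2 * t * √t) with hKdef
  have hKz : ∀ t, t < a ^ 2 → K t = 0 := by
    intro t ht
    have h1 : √t < a := by
      rw [Real.sqrt_lt' ha]
      exact ht
    simp only [hKdef]
    rw [hz _ fun h' => lt_asymm h1 h'.1, zero_div]
  have hKb : ∀ t, b ^ 2 ≤ t → K t = 0 := by
    intro t ht
    have h1 : b ≤ √t := Real.le_sqrt_of_sq_le ht
    simp only [hKdef]
    rw [hz _ fun h' => not_lt.2 h1 h'.2, zero_div]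
  have hKc : ContDiff ℝ (⊤ : ℕ∞) K := by
    rw [contDiff_iff_contDiffAt]
    intro t
    rcases lt_or_ge t (a ^ 2) with ht | ht
    · have : K =ᶠ[𝓝 t] fun _ => 0 := by
        filter_upwards [Iio_mem_nhds ht] with s hs using hKz s hs
      exact contDiffAt_const.congr_of_eventuallyEq this
    · have ht0 : 0 < t := (pow_pos ha 2).trans_le ht
      have h1 : ContDiffAt ℝ (⊤ : ℕ∞) (fun s : ℝ => √s) t := contDiffAt_id.sqrt ht0.ne'
      refine (h.contDiff.contDiffAt.comp t h1).div
        ((contDiffAt_const.mul contDiffAt_id).mul h1) ?_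
      have := Real.sqrt_pos.2 ht0
      positivity
  set H : ℝ → ℝ := fun t => ∫ s in (b ^ 2)..t, K s with hHdef
  have hHd : ∀ t, HasDerivAt H (K t) t := fun t =>
    (hKc.continuous.integral_hasStrictDerivAt _ t).hasDerivAt
  have hHc : ContDiff ℝ (⊤ : ℕ∞) H := by
    rw [contDiff_infty_iff_deriv, show _root_.deriv H = K from funext fun t => (hHd t).deriv]
    exact ⟨fun t => (hHd t).differentiableAt, hKc⟩
  have hKd : ∀ t, HasDerivAt K (_root_.deriv K t) t := fun t =>
    ((hKc.differentiable (by simp)) t).hasDerivAt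
  have hHz : ∀ t, b ^ 2 ≤ t → H t = 0 := by
    intro t ht
    simp only [hHdef]
    rw [intervalIntegral.integral_of_le ht]
    exact setIntegral_eq_zero_of_forall_eq_zero fun s hs => hKb s hs.1.le
  refine ⟨H, hHc, ⟨hHc.comp (contDiff_norm_sq ℝ), ?_⟩, ?_, ?_, b, ?_⟩
  · refine HasCompactSupport.intro (isCompact_closedBall (0 : R3) b) fun x hx => hHz _ ?_
    have h1 : b < ‖x‖ := by simpa using hx
    gcongr
  · intro x
    rw [laplacian_comp_norm_sq hHd hKd]
    rcases eq_or_lt_of_le (norm_nonneg x) with hx | hx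
    · rw [← hx]
      simp only [ne_eq, OfNat.ofNat_ne_zero, not_false_eq_true, zero_pow, mul_zero, zero_mul,
        zero_add, div_zero]
      rw [hKz 0 (by positivity), mul_zero]
    · set r := ‖x‖ with hr
      have ht : r ^ 2 ≠ 0 := by positivity
      have hs : √(r ^ 2) = r := Real.sqrt_sq hx.le
      have e1 := (h.hasDerivAt (√(r ^ 2))).comp (r ^ 2) (Real.hasDerivAt_sqrt ht)
      have e2 := ((hasDerivAt_id' (r ^ 2)).const_mul 2).mul (Real.hasDerivAt_sqrt ht)
      have e3 := (e1.div e2 (by simp [hs, hx.ne'])).deriv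
      have e4 : _root_.deriv K (r ^ 2) = _ := e3
      rw [e4]
      simp only [hKdef, Function.comp_def, Pi.mul_apply, hs]
      field_simp
      ring
  · intro r hr
    refine ((hHd (r ^ 2)).comp r (hasDerivAt_pow 2 r)).congr_deriv ?_
    simp only [hKdef, Real.sqrt_sq hr.le]
    norm_num
    field_simp
  · intro r hr
    exact hHz _ (by gcongr)

/-! ### The radial Poisson equation in the sense of distributions -/

theorem integrableOn_Ioc_of_locallyIntegrable_radial {f : ℝ → ℝ}
    (hf : LocallyIntegrable fun x : R3 => f ‖x‖) (R : ℝ) :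
    IntegrableOn (fun s => f s * s ^ 2) (Ioc 0 R) := by
  have h1 : IntegrableOn (fun x : R3 => f ‖x‖) (Metric.ball 0 (R + 1)) :=
    (hf.integrableOn_isCompact (isCompact_closedBall 0 (R + 1))).mono_set
      Metric.ball_subset_closedBall
  rw [integrableOn_fun_norm_addHaar] at h1
  simp only [finrank_euclideanSpace, Fintype.card_fin, Nat.add_one_sub_one, smul_eq_mul] at h1
  refine (h1.mono_set fun s hs => ⟨hs.1, hs.2.trans_lt (lt_add_one R)⟩).congr_fun
    (fun s _ => mul_comm _ _) measurableSet_Ioc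

theorem locallyIntegrableOn_Ioi_of_locallyIntegrable_radial {f : ℝ → ℝ}
    (hf : LocallyIntegrable fun x : R3 => f ‖x‖) : LocallyIntegrableOn f (Ioi 0) := by
  rw [locallyIntegrableOn_iff isOpen_Ioi.isLocallyClosed]
  intro k hk hkc
  obtain ⟨a, b, ha, hab, hsub⟩ := hkc.exists_subset_Ioo_of_subset_Ioi hk
  have h1 : IntegrableOn (fun s => f s * s ^ 2) k :=
    (integrableOn_Ioc_of_locallyIntegrable_radial hf b).mono_set fun s hs =>
      ⟨ha.trans (hsub hs).1, (hsub hs).2.le⟩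
  have h2 : ContinuousOn (fun s : ℝ => (s ^ 2)⁻¹) k := fun s hs =>
    ((continuousAt_id.pow 2).inv₀ (pow_ne_zero 2 (ne_of_gt (hk hs)))).continuousWithinAt
  refine (h1.mul_continuousOn h2 hkc).congr_fun (fun s hs => ?_) hkc.measurableSet
  have : s ≠ 0 := ne_of_gt (hk hs)
  field_simp

theorem setIntegral_Ioi_eq_intervalIntegral_of_zero_above {f : ℝ → ℝ} {b : ℝ} (hb : 0 ≤ b)
    (hf : ∀ r, b < r → f r = 0) : ∫ r in Ioi 0, f r = ∫ r in (0 : ℝ)..b, f r := by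
  rw [intervalIntegral.integral_of_le hb]
  exact setIntegral_eq_of_subset_of_forall_sdiff_eq_zero measurableSet_Ioi Ioc_subset_Ioi_self
    fun r hr => hf r (lt_of_not_ge fun h => hr.2 ⟨hr.1, h⟩)

theorem exists_integral_radial : ∃ c : ℝ, c ≠ 0 ∧
    ∀ f : ℝ → ℝ, ∫ x : R3, f ‖x‖ = c * ∫ r in Ioi 0, f r * r ^ 2 := by
  refine ⟨3 * (volume : Measure R3).real (Metric.ball 0 1), ?_, fun f => ?_⟩
  · have : 0 < (volume : Measure R3).real (Metric.ball 0 1) :=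
      ENNReal.toReal_pos (Metric.measure_ball_pos _ _ one_pos).ne' measure_ball_lt_top.ne
    positivity
  · rw [integral_fun_norm_addHaar]
    simp only [finrank_euclideanSpace, Fintype.card_fin, Nat.add_one_sub_one, smul_eq_mul,
      nsmul_eq_mul, Nat.cast_ofNat, mul_assoc, mul_comm (f _)]

/-- The flux `r² v'` of a radial distributional solution of `Δ v = f` is the integral of `f s²`
from the origin. No constant of integration occurs in the flux, since the equation is tested
across the origin: such a constant would be a Dirac mass in `Δ v`. -/
theorem exists_ae_eq_of_radial_laplacian_eq {v f : ℝ → ℝ}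
    (hv : LocallyIntegrable fun x : R3 => v ‖x‖) (hf : LocallyIntegrable fun x : R3 => f ‖x‖)
    (h : ∀ ψ : R3 → ℝ, IsTestFunction ψ → ∫ x, v ‖x‖ * Δ ψ x = ∫ x, f ‖x‖ * ψ x) :
    ContinuousOn (fun s => (∫ t in (0 : ℝ)..s, f t * t ^ 2) / s ^ 2) (Ioi 0) ∧
    ∃ c, ∀ᵐ r, r ∈ Ioi (0 : ℝ) →
      v r = c + ∫ s in (1 : ℝ)..r, (∫ t in (0 : ℝ)..s, f t * t ^ 2) / s ^ 2 := by
  have hfi := integrableOn_Ioc_of_locallyIntegrable_radial hf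
  have hfI : ∀ b, 0 ≤ b → IntervalIntegrable (fun t => f t * t ^ 2) volume 0 b := fun b hb => by
    rw [intervalIntegrable_iff_integrableOn_Ioc_of_le hb]
    exact hfi b
  set Q : ℝ → ℝ := fun s => ∫ t in (0 : ℝ)..s, f t * t ^ 2 with hQ
  have hac : ∀ b, 0 ≤ b → AbsolutelyContinuousOnInterval Q 0 b := fun b hb =>
    (hfI b hb).absolutelyContinuousOnInterval_intervalIntegral left_mem_uIcc
  have hQc : ContinuousOn Q (Ioi 0) := by
    intro r hr
    have hr0 : 0 < r := hr
    have h1 := (hac (r + 1) (by linarith)).continuousOn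
    rw [uIcc_of_le (by linarith)] at h1
    exact (h1.continuousAt (Icc_mem_nhds hr0 (by linarith))).continuousWithinAt
  have hqc : ContinuousOn (fun s => Q s / s ^ 2) (Ioi 0) :=
    hQc.div (continuousOn_id.pow 2) fun s hs => pow_ne_zero 2 (ne_of_gt hs)
  refine ⟨hqc, exists_ae_eq_const_add_integral
    (locallyIntegrableOn_Ioi_of_locallyIntegrable_radial hv) hqc fun χ hχ => ?_⟩
  obtain ⟨H, hHc, hHt, hΔ, hHd, b₀, hHb₀⟩ := hχ.exists_radial
  obtain ⟨a, b₁, ha, hab₁, hsub⟩ := hχ.exists_bounds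
  set b := max b₀ b₁ with hb
  have hb0 : 0 < b := (ha.trans hab₁).trans_le (le_max_right _ _)
  have hHb : ∀ r, b ≤ r → H (r ^ 2) = 0 := fun r hr => hHb₀ r ((le_max_left _ _).trans hr)
  have hχz : ∀ r, r ∉ Ioc 0 b → χ r = 0 := fun r hr =>
    image_eq_zero_of_notMem_tsupport fun h' =>
      hr ⟨ha.trans (hsub h').1, (hsub h').2.le.trans (le_max_right _ _)⟩
  obtain ⟨c, hc, hpol⟩ := exists_integral_radial
  have h1 := h _ hHt
  simp only [hΔ] at h1
  rw [hpol fun r => v r * (deriv χ r / r ^ 2), hpol fun r => f r * H (r ^ 2)] at h1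
  have h2 := mul_left_cancel₀ hc h1
  have h3 : ∫ r in Ioi 0, v r * (deriv χ r / r ^ 2) * r ^ 2 = ∫ r in Ioi 0, v r * deriv χ r := by
    refine setIntegral_congr_fun measurableSet_Ioi fun r hr => ?_
    have : r ≠ 0 := ne_of_gt hr
    field_simp
  have h4 : ∫ r in Ioi 0, f r * H (r ^ 2) * r ^ 2 = ∫ r in (0 : ℝ)..b, f r * r ^ 2 * H (r ^ 2) := by
    rw [← setIntegral_Ioi_eq_intervalIntegral_of_zero_above hb0.le fun r hr => by
      rw [hHb r hr.le, mul_zero]]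
    exact setIntegral_congr_fun measurableSet_Ioi fun r _ => by ring
  have h5 : ∫ r in Ioi 0, Q r / r ^ 2 * χ r = ∫ r in (0 : ℝ)..b, Q r / r ^ 2 * χ r :=
    setIntegral_Ioi_eq_intervalIntegral le_rfl hb0.le fun r hr => by rw [hχz r hr, mul_zero]
  have hHsq : ContDiff ℝ 1 fun s : ℝ => H (s ^ 2) :=
    (hHc.of_le (by simp)).comp (contDiff_id.pow 2)
  have h6 := (hac b hb0.le).integral_mul_deriv_eq_deriv_mul
    (g := fun s : ℝ => H (s ^ 2)) (hHsq.contDiffOn.absolutelyContinuousOnInterval)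
  have hQ0 : Q 0 = 0 := intervalIntegral.integral_same
  rw [hHb b le_rfl, hQ0, mul_zero, zero_mul, sub_zero, zero_sub] at h6
  have h7 : ∫ r in (0 : ℝ)..b, Q r * deriv (fun s : ℝ => H (s ^ 2)) r
      = ∫ r in (0 : ℝ)..b, Q r / r ^ 2 * χ r := by
    rw [intervalIntegral.integral_of_le hb0.le, intervalIntegral.integral_of_le hb0.le]
    refine setIntegral_congr_fun measurableSet_Ioc fun r hr => ?_
    simp only [(hHd r hr.1).deriv]
    ring
  have h8 : ∫ r in (0 : ℝ)..b, deriv Q r * H (r ^ 2)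
      = ∫ r in (0 : ℝ)..b, f r * r ^ 2 * H (r ^ 2) := by
    refine intervalIntegral.integral_congr_ae ?_
    filter_upwards [(hfI b hb0.le).ae_hasDerivAt_integral] with r hr hr'
    rw [(hr (uIoc_subset_uIcc hr') 0 left_mem_uIcc).deriv]
  rw [← h3, h2, h4, h5, ← h7, h6, h8, neg_neg]

/-! ### Back to functions on space -/

/-- Polar coordinates: null sets of radii give null sets of points. -/
theorem ae_norm_of_ae_Ioi {p : ℝ → Prop} (h : ∀ᵐ r, r ∈ Ioi (0 : ℝ) → p r) :
    ∀ᵐ x : R3, p ‖x‖ := by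
  classical
  set F : ℝ → ℝ := fun r => if p r then 0 else 1 with hF
  have h0 : ∀ᵐ r ∂(volume.restrict (Ioi (0 : ℝ))), F r = 0 := by
    rw [ae_restrict_iff' measurableSet_Ioi]
    filter_upwards [h] with r hr hr0
    simp [hF, hr hr0]
  have hi : Integrable (fun x : R3 => F ‖x‖) := by
    rw [integrable_fun_norm_addHaar]
    refine (integrable_zero ℝ ℝ _).congr ?_
    filter_upwards [h0] with r hr
    simp [hr]
  obtain ⟨c, -, hc⟩ := exists_integral_radial
  have h1 : ∫ x : R3, F ‖x‖ = 0 := by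
    rw [hc F, integral_eq_zero_of_ae, mul_zero]
    filter_upwards [h0] with r hr
    simp [hr]
  have h2 := (integral_eq_zero_iff_of_nonneg (fun x => by
    simp only [hF, Pi.zero_apply]
    split_ifs <;> norm_num) hi).1 h1
  filter_upwards [h2] with x hx
  by_contra hcon
  simp [hF, hcon] at hx

theorem MeasureTheory.LocallyIntegrable.congr_ae {f g : R3 → ℝ} (hf : LocallyIntegrable f)
    (h : f =ᵐ[volume] g) : LocallyIntegrable g := fun x =>
  let ⟨s, hs, hi⟩ := hf x
  ⟨s, hs, hi.congr_fun_ae (ae_restrict_of_ae h)⟩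

theorem MeasureTheory.LocallyIntegrable.integrable_mul_testFunction {f ψ : R3 → ℝ}
    (hf : LocallyIntegrable f) (hψ : IsTestFunction ψ) : Integrable (fun x => f x * ψ x) :=
  hf.integrable_smul_right_of_hasCompactSupport hψ.1.continuous hψ.2

/-- The profiles of a radial solution agree almost everywhere with `C¹` ones that solve the
radial system. -/
theorem exists_isRadialProfile {g γ : ℝ → ℝ} {ω : ℝ}
    (hsol : IsMaxwellSchrodingerSolution (fun x => g ‖x‖) (fun x => γ ‖x‖) ω)
    (hL2 : Integrable fun x : R3 => g ‖x‖ ^ 2) :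
    ∃ U Q m : ℝ → ℝ, ∃ c : ℝ,
      IsRadialProfile (4 * Real.pi) ω U Q (fun r => c + ∫ s in (1 : ℝ)..r, m s / s ^ 2) m ∧
      (∀ᵐ r, r ∈ Ioi (0 : ℝ) → g r = U r) ∧
      ∀ᵐ r, r ∈ Ioi (0 : ℝ) → γ r = c + ∫ s in (1 : ℝ)..r, m s / s ^ 2 := by
  obtain ⟨hg, hγ, hγg, hg2, hequ, heqφ⟩ := hsol
  have hf1 : LocallyIntegrable fun x : R3 => -2 * (γ ‖x‖ + ω) * g ‖x‖ := by
    have h1 := (hγg.smul (-2 : ℝ)).add (hg.smul (-2 * ω))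
    refine h1.congr_ae (Eventually.of_forall fun x => ?_)
    change -2 * (γ ‖x‖ * g ‖x‖) + -2 * ω * g ‖x‖ = _
    ring
  have hf2 : LocallyIntegrable fun x : R3 => 4 * Real.pi * g ‖x‖ ^ 2 := hg2.smul (4 * Real.pi)
  obtain ⟨hc1, c₁, hU⟩ := exists_ae_eq_of_radial_laplacian_eq
    (v := g) (f := fun r => -2 * (γ r + ω) * g r) hg hf1 fun ψ hψ => by
      have h1 := hequ ψ hψ
      have h2 : (fun x : R3 => -2 * (γ ‖x‖ + ω) * g ‖x‖ * ψ x)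
          = fun x : R3 => -2 * (γ ‖x‖ * g ‖x‖ * ψ x) + -2 * ω * (g ‖x‖ * ψ x) := by
        ext x; ring
      rw [h2, integral_add ((hγg.integrable_mul_testFunction hψ).const_mul _)
        ((hg.integrable_mul_testFunction hψ).const_mul _), integral_const_mul,
        integral_const_mul]
      linarith
  obtain ⟨hc2, c₂, hΦ⟩ := exists_ae_eq_of_radial_laplacian_eq
    (v := γ) (f := fun r => 4 * Real.pi * g r ^ 2) hγ hf2 fun ψ hψ => by
      rw [heqφ ψ hψ, ← integral_const_mul]
      simp only [mul_assoc]
  set Q : ℝ → ℝ := fun s => ∫ t in (0 : ℝ)..s, -2 * (γ t + ω) * g t * t ^ 2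
  set m : ℝ → ℝ := fun s => ∫ t in (0 : ℝ)..s, 4 * Real.pi * g t ^ 2 * t ^ 2
  set U : ℝ → ℝ := fun r => c₁ + ∫ s in (1 : ℝ)..r, Q s / s ^ 2
  set Φ : ℝ → ℝ := fun r => c₂ + ∫ s in (1 : ℝ)..r, m s / s ^ 2
  refine ⟨U, Q, m, c₂, ⟨?_, ?_, ?_, ?_, ?_, ?_⟩, hU, hΦ⟩
  · exact fun r hr => (hasDerivAt_integral_one hc1 hr).const_add c₁
  · exact fun r hr => (hasDerivAt_integral_one hc2 hr).const_add c₂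
  · have h1 := (integrable_fun_norm_addHaar (volume : Measure R3) (f := fun r => g r ^ 2)).1 hL2
    simp only [finrank_euclideanSpace, Fintype.card_fin, Nat.add_one_sub_one, smul_eq_mul] at h1
    refine h1.congr_fun_ae ((ae_restrict_iff' measurableSet_Ioi).2 ?_)
    filter_upwards [hU] with r h2 hr
    rw [h2 hr, mul_comm]
  · intro R
    refine (integrableOn_Ioc_of_locallyIntegrable_radial
      (f := fun r => -2 * (γ r + ω) * g r) hf1 R).congr_fun_ae
      ((ae_restrict_iff' measurableSet_Ioc).2 ?_)
    filter_upwards [hU, hΦ] with r h2 h3 hr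
    rw [h2 hr.1, h3 hr.1]
  · intro r hr
    refine intervalIntegral.integral_congr_ae ?_
    filter_upwards [hU, hΦ] with s h2 h3 hs
    rw [uIoc_of_le hr.le] at hs
    rw [h2 hs.1, h3 hs.1]
  · intro r hr
    refine intervalIntegral.integral_congr_ae ?_
    filter_upwards [hU] with s h2 hs
    rw [uIoc_of_le hr.le] at hs
    rw [h2 hs.1]

theorem IsMaxwellSchrodingerSolution.congr_ae {u φ u' φ' : R3 → ℝ} {ω : ℝ}
    (h : IsMaxwellSchrodingerSolution u φ ω) (hu : u =ᵐ[volume] u') (hφ : φ =ᵐ[volume] φ') :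
    IsMaxwellSchrodingerSolution u' φ' ω := by
  obtain ⟨h1, h2, h3, h4, h5, h6⟩ := h
  refine ⟨h1.congr_ae hu, h2.congr_ae hφ, h3.congr_ae (hφ.mul hu), h4.congr_ae (hu.pow_const 2),
    fun ψ hψ => ?_, fun ψ hψ => ?_⟩
  · have e1 : ∫ x, u' x * Δ ψ x = ∫ x, u x * Δ ψ x :=
      integral_congr_ae (hu.symm.mul (ae_eq_refl _))
    have e2 : ∫ x, φ' x * u' x * ψ x = ∫ x, φ x * u x * ψ x :=
      integral_congr_ae ((hφ.symm.mul hu.symm).mul (ae_eq_refl _))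
    have e3 : ∫ x, u' x * ψ x = ∫ x, u x * ψ x :=
      integral_congr_ae (hu.symm.mul (ae_eq_refl _))
    rw [e1, e2, e3]
    exact h5 ψ hψ
  · have e1 : ∫ x, φ' x * Δ ψ x = ∫ x, φ x * Δ ψ x :=
      integral_congr_ae (hφ.symm.mul (ae_eq_refl _))
    have e2 : ∫ x, u' x ^ 2 * ψ x = ∫ x, u x ^ 2 * ψ x :=
      integral_congr_ae ((hu.symm.pow_const 2).mul (ae_eq_refl _))
    rw [e1, e2]
    exact h6 ψ hψ

theorem MemD12.memLp_six {f : R3 → ℝ} (h : MemD12 f) : MemLp f 6 := by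
  obtain ⟨G, hG, -, ψ, hψ, -, hlim⟩ := h
  obtain ⟨n, hn⟩ := (hlim.eventually_lt_const ENNReal.zero_lt_top).exists
  have h1 : MemLp (ψ n) 6 := (hψ n).1.continuous.memLp_of_hasCompactSupport (hψ n).2
  have h2 : MemLp (fun x => ψ n x - f x) 6 :=
    ⟨h1.aestronglyMeasurable.sub hG.1.aestronglyMeasurable, hn⟩
  refine (h1.sub h2).ae_eq (Eventually.of_forall fun x => ?_)
  simp

theorem MemD12.eq_zero_of_ae_eq_const {f : R3 → ℝ} (h : MemD12 f) {c : ℝ}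
    (hc : ∀ᵐ x, f x = c) : c = 0 := by
  have h1 : MemLp (fun _ : R3 => c) 6 := h.memLp_six.ae_eq hc
  rw [memLp_const_iff (by norm_num) (by norm_num)] at h1
  simpa using h1

theorem theorem1p1 (u φ : R3 → ℝ) (ω : ℝ)
    (hsol : IsMaxwellSchrodingerSolution u φ ω)
    (hu_rad : IsRadial u) (hφ_rad : IsRadial φ)
    (hu : MemH1 u) (hφ : HasL2Gradient φ) :
    (∀ᵐ x : R3, u x = 0) ∧
    (∃ c : ℝ, ∀ᵐ x : R3, φ x = c) ∧
    (MemD12 φ → ∀ᵐ x : R3, φ x = 0) := by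
  obtain ⟨g, hg⟩ := hu_rad
  obtain ⟨γ, hγ⟩ := hφ_rad
  have hL2 : Integrable fun x : R3 => g ‖x‖ ^ 2 :=
    hu.1.integrable_sq.congr (EventuallyEq.pow_const hg 2)
  obtain ⟨U, Q, m, c, hP, hgU, hγΦ⟩ := exists_isRadialProfile (hsol.congr_ae hg hγ) hL2
  have hκ : 0 < 4 * Real.pi := by positivity
  have hu0 : ∀ᵐ x : R3, u x = 0 := by
    filter_upwards [hg, ae_norm_of_ae_Ioi (p := fun r => g r = 0) (by
      filter_upwards [hgU] with r hr hr0
      rw [hr hr0, hP.eq_zero hκ hr0])] with x h1 h2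
    rw [h1, h2]
  have hφc : ∀ᵐ x : R3, φ x = c := by
    filter_upwards [hγ, ae_norm_of_ae_Ioi (p := fun r => γ r = c) (by
      filter_upwards [hγΦ] with r hr hr0
      rw [hr hr0, add_eq_left]
      refine intervalIntegral.integral_zero_ae (Eventually.of_forall fun s hs => ?_)
      rw [hP.m_eq_zero hκ ((lt_min one_pos hr0).trans hs.1), zero_div])] with x h1 h2
    rw [h1, h2]
  refine ⟨hu0, ⟨c, hφc⟩, fun hD => ?_⟩
  filter_upwards [hφc] with x hx
  rw [hx, hD.eq_zero_of_ae_eq_const hφc]
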